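/- Let $(X,d)$ and $(Y,d_Y)$ be compact metric spaces and let $f_y:X\to X$, $y\in Y$, be continuous maps generating the free semigroup action $G$. For a word $w=i_1\cdots i_n\in Y^n$ write $f_w=f_{i_1}\circ\cdots\circ f_{i_n}$ ($f_\emptyset=\mathrm{id}$), $\overline w=i_n\cdots i_1$, and $$d_w(x_1,x_2)=\max_{0\le j\le n}d\big(f_{i_j\cdots i_1}(x_1),f_{i_j\cdots i_1}(x_2)\big),\qquad B_w(x,\delta)=\{y\in X: d_w(x,y)<\delta\}.$$ For $\omega=(i_1i_2\cdots)\in Y^{\mathbb N}$ let $\omega|_{[1,n]}=i_1\cdots i_n$. $G$ has the gluing orbit property if for every $\varepsilon>0$ there is an integer $\mathfrak p(\varepsilon)>0$ such that for all $k\ge 2$, all $x_1,\dots,x_k\in X$, all $n_1,\dots,n_k\ge 1$ and all words $w_j\in Y^{n_j}$ $(1\le j\le k)$ there are $0\le p_1,\dots,p_{k-1}\le\mathfrak p(\varepsilon)$ such that for all words $v_j\in Y^{p_j}$ $(1\le j\le k-1)$ $$B_{w_1}(x_1,\varepsilon)\cap\bigcap_{j=2}^k \big(f_{\overline{v_{j-1}}\,\overline{w_{j-1}}\cdots\overline{v_1}\,\overline{w_1}}\big)^{-1}B_{w_j}(x_j,\varepsilon)\ne\emptyset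 .$$ A Borel probability measure $\nu$ on $Y$ is homogeneous if there is $L>0$ with $\nu(B(y_1,2\varepsilon))\le L\,\nu(B(y_2,\varepsilon))$ for all $y_1,y_2\in\operatorname{supp}\nu$ and $\varepsilon>0$. The upper box dimension is $\overline{\dim}_BY=\limsup_{\varepsilon\to0}\log N(\varepsilon)/\log\frac1\varepsilon$, where $N(\varepsilon)$ is the maximal cardinality of an $\varepsilon$-separated subset of $Y$. Put $\mathbb P=\nu^{\mathbb N}$ on $Y^{\mathbb N}$. All dimensions below take values in $[-\infty,\infty]$, and integrals of nonnegative functions over $Y^{\mathbb N}$ are read as lower integrals if measurability fails. Let $s(w,\varepsilon)$ be the maximal cardinality of a subset of $X$ whose distinct points have $d_w$-distance $>\varepsilon$, and $$\overline{\mathrm{mdim}}_M(X,G,d,\mathbb P)=\limsup_{\varepsilon\to0}\frac{1}{-\log\varepsilon}\limsup_{n\to\infty}\frac1n\log\int_{Y^{\mathbb N}}s(\omega|_{[1,n]},\varepsilon)\,d\mathbb P(\omega)$$ (the upper metric mean dimension of the whole action, due to Carvalho et al.). For $Z\subset X$, $w=i_1\cdots i_N\in Y^N$ and $\varepsilon>0$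 let $\Lambda_w(Z,N,\varepsilon)$ be the infimum, over all open covers $\mathcal U$ of $X$ with $\sup_{U\in\mathcal U}\operatorname{diam}U<\varepsilon$ and all countable collections $\mathcal G$ of strings $\mathbf U=(U_0,\dots,U_N)\in\mathcal U^{N+1}$ such that the sets $\{x: f_{i_j\cdots i_1}(x)\in U_j,\ 0\le j\le N\}$, $\mathbf U\in\mathcal G$, cover $Z$, of the cardinality of $\mathcal G$. Put $$\overline{\mathrm{umdim}}_Z(\varepsilon,G,d,\mathbb P)=\inf\Big\{\lambda\in\mathbb R:\ \limsup_{N\to\infty}\int_{Y^{\mathbb N}} e^{-\lambda(N+1)}\Lambda_{\omega|_{[1,N]}}(Z,N,\varepsilon)\,d\mathbb P(\omega)=0\Big\},$$ and let the $u$-upper metric mean dimension of $G$ on $Z$ be $\overline{\mathrm{umdim}}_Z(G,d,\mathbb P)=\limsup_{\varepsilon\to0}\overline{\mathrm{umdim}}_Z(\varepsilon,G,d,\mathbb P)/\log\frac1\varepsilon$. For $m\in\mathbb N$ and a continuous $\varphi:X\to\mathbb R^m$ let $I_\varphi(G)$ be the set of all $x\in X$ for which there is $\omega\in Y^{\mathbb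 N}$ such that $\lim_{n\to\infty}\frac1n\sum_{j=0}^{n-1}\varphi\big(f_{\overline{\omega|_{[1,j]}}}(x)\big)$ does not exist. **Theorem.** Suppose that $G$ has the gluing orbit property, that $\overline{\dim}_BY<\infty$, and that $\nu$ is a homogeneous Borel probability measure on $Y$ with $\operatorname{supp}\nu=Y$. Let $\varphi:X\to\mathbb R^m$ be continuous. If $I_\varphi(G)\neq\emptyset$, then $$\overline{\mathrm{umdim}}_{I_\varphi(G)}(G,d,\mathbb P)=\overline{\mathrm{mdim}}_M(X,G,d,\mathbb P)=\overline{\mathrm{umdim}}_X(G,d,\mathbb P).$$ -/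

import Mathlib

open MeasureTheory Filter Topology

noncomputable section

namespace FreeSemigroup

variable {X Y : Type*}

/-! Words over the alphabet `Y` are lists; an infinite word `ω = (i₁ i₂ ⋯)` is a function `ℕ → Y`
with `i_{j+1} = ω j`. -/

/-- `f_w = f_{i₁} ∘ ⋯ ∘ f_{i_k}` for the word `w = i₁ ⋯ i_k`, and `f_∅ = id`. -/
def wordMap (f : Y → X → X) : List Y → X → X
  | [] => id
  | y :: w => f y ∘ wordMap f w

/-- `ω|_{[1,n]} = i₁ ⋯ i_n`. -/
def firstWord (ω : ℕ → Y) (n : ℕ) : List Y := (List.range n).map ω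

/-- The metric `d_w(x₁, x₂) = max_{w' ≤ w̄} d(f_{w'} x₁, f_{w'} x₂)`, where `w̄` is the reversed word
and `w' ≤ w̄` means that `w'` is a suffix of `w̄` (finitely many, the empty word included). -/
def wordDist [MetricSpace X] (f : Y → X → X) (w : List Y) (x₁ x₂ : X) : ℝ :=
  ⨆ w' : {w' : List Y // w' <:+ w.reverse}, dist (wordMap f w' x₁) (wordMap f w' x₂)

/-- The Bowen ball `B_w(x, δ)`. -/
def bowenBall [MetricSpace X] (f : Y → X → X) (w : List Y) (x : X) (δ : ℝ) : Set X :=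
  {y | wordDist f w x y < δ}

/-- `glueWord w v j` is the word `v̄_{j-1} w̄_{j-1} ⋯ v̄₀ w̄₀`. -/
def glueWord (w v : ℕ → List Y) : ℕ → List Y
  | 0 => []
  | j + 1 => (v j).reverse ++ (w j).reverse ++ glueWord w v j

/-- The gluing orbit property. Finite families `(a₁, …, a_k)` are written as `a 0, …, a (k - 1)`
with `a` a sequence whose other terms play no role. -/
def GluingOrbitProperty [MetricSpace X] (f : Y → X → X) : Prop :=
  ∀ ε : ℝ, 0 < ε → ∃ P : ℕ, 0 < P ∧
    ∀ k : ℕ, 2 ≤ k → ∀ (x : ℕ → X) (w : ℕ → List Y), (∀ j < k, 0 < (w j).length) →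
      ∃ p : ℕ → ℕ, (∀ j < k - 1, p j ≤ P) ∧
        ∀ v : ℕ → List Y, (∀ j < k - 1, (v j).length = p j) →
          (bowenBall f (w 0) (x 0) ε ∩
            ⋂ j ∈ Finset.Ico 1 k,
              wordMap f (glueWord w v j) ⁻¹' bowenBall f (w j) (x j) ε).Nonempty

/-- A homogeneous Borel measure. -/
def IsHomogeneous [MetricSpace Y] [MeasurableSpace Y] (ν : Measure Y) : Prop :=
  ∃ L : NNReal, 0 < L ∧ ∀ y₁ ∈ ν.support, ∀ y₂ ∈ ν.support, ∀ ε : ℝ, 0 < ε →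
    ν (Metric.ball y₁ (2 * ε)) ≤ L * ν (Metric.ball y₂ ε)

/-- The upper box dimension of `Y`; the packing number is the maximal cardinality of an
`ε`-separated set. -/
def upperBoxDim (Y : Type*) [MetricSpace Y] : EReal :=
  limsup (fun ε : ℝ =>
    ENNReal.log (Metric.packingNumber ε.toNNReal (Set.univ : Set Y) : ENNReal) /
      (Real.log (1 / ε) : EReal)) (𝓝[>] 0)

/-- The random walk `ν^ℕ` on `Y^ℕ`. -/
def randomWalk [MeasurableSpace Y] (ν : Measure Y) : Measure (ℕ → Y) :=
  Measure.infinitePi fun _ : ℕ => ν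

section WholeSpace

/-- `s(w, ε, Z, G)`: the maximal cardinality of a subset of `Z` whose distinct points have
`d_w`-distance `> ε`. -/
def sepCard [MetricSpace X] (f : Y → X → X) (w : List Y) (ε : ℝ) (Z : Set X) : ℕ∞ :=
  ⨆ (K : Set X) (_ : K ⊆ Z) (_ : K.Pairwise fun x₁ x₂ => ε < wordDist f w x₁ x₂), K.encard

/-- `h(X, G, ℙ, ε)`. -/
def entropyAt [MetricSpace X] [MeasurableSpace Y] (f : Y → X → X) (ℙ : Measure (ℕ → Y))
    (ε : ℝ) : EReal :=
  limsup (fun n : ℕ =>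
    ENNReal.log (∫⁻ ω, (sepCard f (firstWord ω n) ε Set.univ : ENNReal) ∂ℙ) / (n : EReal)) atTop

/-- The upper metric mean dimension of the action on the whole phase space. -/
def upperMdimM [MetricSpace X] [MeasurableSpace Y] (f : Y → X → X) (ℙ : Measure (ℕ → Y)) :
    EReal :=
  limsup (fun ε : ℝ => entropyAt f ℙ ε / ((-Real.log ε : ℝ) : EReal)) (𝓝[>] 0)

end WholeSpace

section Subsets

/-- `C(ε)`: the open covers of `X` with diameter less than `ε`. -/
def openCovers (X : Type*) [MetricSpace X] (ε : ℝ) : Set (Set (Set X)) :=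
  {𝒰 | (∀ U ∈ 𝒰, IsOpen U) ∧ ⋃₀ 𝒰 = Set.univ ∧ (⨆ U ∈ 𝒰, Metric.ediam U) < ENNReal.ofReal ε}

/-- `X_w(𝐔) = {x : x ∈ U₀, f_{i₁} x ∈ U₁, …, f_{i_N ⋯ i₁} x ∈ U_N}` for `w = i₁ ⋯ i_N` and a
string `𝐔 = (U₀, …, U_N)`. -/
def stringSet (f : Y → X → X) (w : List Y) (U : Fin (w.length + 1) → Set X) : Set X :=
  {x | ∀ j : Fin (w.length + 1), wordMap f (w.take j).reverse x ∈ U j}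

/-- `Λ_w(Z, N, ε, G, d)` with `N = |w|`: the least cardinality of a countable collection of
strings of length `N + 1` over a cover in `C(ε)` whose sets `X_w(𝐔)` cover `Z`. -/
def coverCard [MetricSpace X] (f : Y → X → X) (w : List Y) (ε : ℝ) (Z : Set X) : ℕ∞ :=
  ⨅ (𝒰 ∈ openCovers X ε) (𝒢 : Set (Fin (w.length + 1) → Set X)) (_ : 𝒢.Countable)
    (_ : ∀ U ∈ 𝒢, ∀ j, U j ∈ 𝒰) (_ : Z ⊆ ⋃ U ∈ 𝒢, stringSet f w U), 𝒢.encard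

/-- `R(Z, lam, N, ε, G, d, ℙ)`. -/
def coverSum [MetricSpace X] [MeasurableSpace Y] (f : Y → X → X) (ℙ : Measure (ℕ → Y))
    (Z : Set X) (lam : ℝ) (N : ℕ) (ε : ℝ) : ENNReal :=
  ∫⁻ ω, ENNReal.ofReal (Real.exp (-lam * (N + 1))) *
    (coverCard f (firstWord ω N) ε Z : ENNReal) ∂ℙ

/-- The critical value at scale `ε`: the infimum of the real `lam` with
`limsup_N R(Z, lam, N, ε, G, d, ℙ) = 0`. -/
def upperUmdimAt [MetricSpace X] [MeasurableSpace Y] (f : Y → X → X) (ℙ : Measure (ℕ → Y))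
    (Z : Set X) (ε : ℝ) : EReal :=
  sInf ((fun lam : ℝ => (lam : EReal)) ''
    {lam : ℝ | limsup (fun N : ℕ => coverSum f ℙ Z lam N ε) atTop = 0})

/-- The `u`-upper metric mean dimension of the action on the subset `Z`. -/
def upperUmdim [MetricSpace X] [MeasurableSpace Y] (f : Y → X → X) (ℙ : Measure (ℕ → Y))
    (Z : Set X) : EReal :=
  limsup (fun ε : ℝ => upperUmdimAt f ℙ Z ε / (Real.log (1 / ε) : EReal)) (𝓝[>] 0)

end Subsets

/-- The set `I_φ(G)` of `φ`-irregular points. -/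
def irregularSet {E : Type*} [AddCommGroup E] [Module ℝ E] [TopologicalSpace E]
    (f : Y → X → X) (φ : X → E) : Set X :=
  {x | ∃ ω : ℕ → Y, ¬ ∃ a : E, Tendsto (fun n : ℕ =>
    (1 / (n : ℝ)) • ∑ j ∈ Finset.range n, φ (wordMap f (firstWord ω j).reverse x)) atTop (𝓝 a)}

end FreeSemigroup

end

/-! The point is that metric mean dimension cannot tell a dense set from the whole space. If
finitely many string sets cover a dense `Z`, their closures cover `X`. Closing a set does not change
its diameter, so two points in the closure of one string set are at `d_w`-distance at most `ε`.
Hence s(w,ε) ≤ Λ_w(Z,ε) ≤ Λ_w(X,ε) ≤ s(w,ε/4) for each word (`sepCard_univ_le_coverCard`,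
`coverCard_mono`, `coverCard_univ_le_sepCard`). Integration uses only monotonicity and finite
constant factors, so measurability plays no role. The factor 4 disappears after division by
log(1/ε), which gives `upperUmdim_eq_of_dense`.

It remains to see that the irregular set is dense (`dense_irregularSet`). Gluing produces a point
that starts near a prescribed `t` and then shadows ever longer initial orbit segments of one
irregular point `x₀`. Each segment dwarfs all the time before it, so the averages of the new point
inherit the oscillation of those of `x₀`. -/

namespace FreeSemigroup

variable {X Y : Type*}

/-! ### Words and their prefixes -/

section Words

theorem wordMap_append (f : Y → X → X) (u v : List Y) (x : X) :
    wordMap f (u ++ v) x = wordMap f u (wordMap f v x) := by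
  induction u with
  | nil => rfl
  | cons y u ih => simp [wordMap, ih]

theorem continuous_wordMap [TopologicalSpace X] {f : Y → X → X} (hf : ∀ y, Continuous (f y))
    (w : List Y) : Continuous (wordMap f w) := by
  induction w with
  | nil => exact continuous_id
  | cons y w ih => exact (hf y).comp ih

@[simp]
theorem length_firstWord (ω : ℕ → Y) (n : ℕ) : (firstWord ω n).length = n := by
  simp [firstWord]

theorem take_firstWord (ω : ℕ → Y) {k n : ℕ} (h : k ≤ n) :
    (firstWord ω n).take k = firstWord ω k := by
  simp [firstWord, ← List.map_take, List.take_range, h]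

/-- An increasing sequence of words of unbounded length is the sequence of initial words of an
infinite word. -/
theorem exists_firstWord_eq [Nonempty Y] (W : ℕ → List Y) (hW : ∀ j, W j <+: W (j + 1))
    (hlen : ∀ j, j ≤ (W j).length) :
    ∃ ω : ℕ → Y, ∀ j, firstWord ω (W j).length = W j := by
  have hmono : ∀ i j, i ≤ j → W i <+: W j := fun i j h =>
    Nat.le_induction (List.prefix_refl _) (fun n _ ih => ih.trans (hW n)) j h
  have hget : ∀ i j k (hi : k < (W i).length) (hj : k < (W j).length),
      (W i)[k] = (W j)[k] := by
    intro i j k hi hj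
    rcases le_total i j with h | h
    · exact (hmono i j h).getElem hi
    · exact ((hmono j i h).getElem hj).symm
  refine ⟨fun i => (W (i + 1))[i]'(hlen (i + 1)), fun j => ?_⟩
  apply List.ext_getElem (by simp)
  intro k h₁ h₂
  simp only [firstWord, List.getElem_map, List.getElem_range]
  exact hget _ _ _ _ _

end Words

/-! ### The Bowen metric -/

section WordDist

variable [MetricSpace X]

/-- Suffixes of `w.reverse` are exactly the reversed prefixes of `w`. -/
theorem wordDist_le {f : Y → X → X} {w : List Y} {x₁ x₂ : X} {r : ℝ}
    (h : ∀ j ≤ w.length,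
      dist (wordMap f (w.take j).reverse x₁) (wordMap f (w.take j).reverse x₂) ≤ r) :
    wordDist f w x₁ x₂ ≤ r := by
  have : Nonempty {w' : List Y // w' <:+ w.reverse} := ⟨⟨[], List.nil_suffix⟩⟩
  refine ciSup_le fun ⟨w', hw'⟩ => ?_
  have hp : w'.reverse <+: w := by rwa [← List.reverse_suffix, List.reverse_reverse]
  have := h w'.reverse.length hp.length_le
  rwa [← List.prefix_iff_eq_take.1 hp, List.reverse_reverse] at this

theorem dist_le_wordDist [CompactSpace X] (f : Y → X → X) (w : List Y) (j : ℕ) (x₁ x₂ : X) :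
    dist (wordMap f (w.take j).reverse x₁) (wordMap f (w.take j).reverse x₂) ≤
      wordDist f w x₁ x₂ := by
  have hb : BddAbove (Set.range fun w' : {w' : List Y // w' <:+ w.reverse} =>
      dist (wordMap f w' x₁) (wordMap f w' x₂)) := by
    refine ⟨Metric.diam (Set.univ : Set X), ?_⟩
    rintro _ ⟨w', rfl⟩
    exact Metric.dist_le_diam_of_mem isCompact_univ.isBounded trivial trivial
  exact le_ciSup hb ⟨(w.take j).reverse, List.reverse_suffix.2 (List.take_prefix j w)⟩

theorem wordDist_self [CompactSpace X] (f : Y → X → X) (w : List Y) (x : X) :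
    wordDist f w x x = 0 :=
  le_antisymm (wordDist_le (by simp)) (by simpa using dist_le_wordDist f w 0 x x)

theorem wordDist_comm (f : Y → X → X) (w : List Y) (x₁ x₂ : X) :
    wordDist f w x₁ x₂ = wordDist f w x₂ x₁ := by
  simp [wordDist, dist_comm]

end WordDist

/-! ### Separated sets versus covers by strings -/

section Counting

variable [MetricSpace X]

/-- Separated sets of the whole space are no larger than covers of a dense set. -/
theorem sepCard_univ_le_coverCard {f : Y → X → X} (hf : ∀ y, Continuous (f y)) {Z : Set X}
    (hZ : Dense Z) (w : List Y) (ε : ℝ) :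
    sepCard f w ε Set.univ ≤ coverCard f w ε Z := by
  refine iSup₂_le fun K _ => iSup_le fun hK => ?_
  refine le_iInf₂ fun 𝒰 h𝒰 => le_iInf₂ fun 𝒢 _ => le_iInf₂ fun h𝒢 hcov => ?_
  -- Closure commutes with finite unions only; an infinite `𝒢` bounds everything.
  rcases 𝒢.finite_or_infinite with hfin | hinf
  swap
  · simp [hinf.encard_eq]
  have hclosure : ∀ x, ∃ U ∈ 𝒢, x ∈ closure (stringSet f w U) := by
    intro x
    have hx : x ∈ closure (⋃ U ∈ 𝒢, stringSet f w U) :=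
      closure_mono hcov (hZ x)
    rw [hfin.closure_biUnion] at hx
    simpa using hx
  choose g hg hxg using hclosure
  -- Points sharing a string have images in the closure of the same `U j` at every time, so they are
  -- not separated.
  have hinj : Set.InjOn g K := by
    intro x hx y hy hxy
    by_contra hne
    refine (hK hx hy hne).not_ge (wordDist_le fun j hj => ?_)
    have hmaps : ∀ z ∈ closure (stringSet f w (g x)),
        wordMap f (w.take j).reverse z ∈ closure (g x ⟨j, Nat.lt_succ_of_le hj⟩) := by
      intro z hz
      exact map_mem_closure (continuous_wordMap hf _) hz
        (fun z hz => hz ⟨j, Nat.lt_succ_of_le hj⟩)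
    have hd : Metric.ediam (g x ⟨j, Nat.lt_succ_of_le hj⟩) < ENNReal.ofReal ε :=
      lt_of_le_of_lt (le_iSup₂ (f := fun U (_ : U ∈ 𝒰) => Metric.ediam U) _
        (h𝒢 _ (hg x) _)) h𝒰.2.2
    have he : edist (wordMap f (w.take j).reverse x) (wordMap f (w.take j).reverse y) ≤
        ENNReal.ofReal ε := by
      refine le_trans ?_ hd.le
      rw [← Metric.ediam_closure]
      exact Metric.edist_le_ediam_of_mem (hmaps x (hxg x)) (hmaps y (by rw [hxy]; exact hxg y))
    have hε : 0 ≤ ε := by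
      by_contra h
      rw [ENNReal.ofReal_of_nonpos (not_le.1 h).le] at hd
      exact not_lt_zero hd
    rw [edist_dist] at he
    exact (ENNReal.ofReal_le_ofReal_iff hε).1 he
  exact Set.encard_le_encard_of_injOn (fun x _ => hg x) hinj

theorem coverCard_mono (f : Y → X → X) (w : List Y) (ε : ℝ) {Z Z' : Set X} (h : Z ⊆ Z') :
    coverCard f w ε Z ≤ coverCard f w ε Z' := by
  refine le_iInf₂ fun 𝒰 h𝒰 => le_iInf₂ fun 𝒢 hc => le_iInf₂ fun h𝒢 hcov => ?_
  exact iInf₂_le_of_le 𝒰 h𝒰 <| iInf₂_le_of_le 𝒢 hc <| iInf₂_le_of_le h𝒢 (h.trans hcov) le_rfl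

theorem exists_maximal_wordDist_separated (f : Y → X → X) (w : List Y) (r : ℝ) :
    ∃ K : Set X, (K.Pairwise fun x₁ x₂ => r < wordDist f w x₁ x₂) ∧
      ∀ x ∉ K, ∃ y ∈ K, wordDist f w y x ≤ r := by
  obtain ⟨K, hK⟩ := zorn_subset {K : Set X | K.Pairwise fun x₁ x₂ => r < wordDist f w x₁ x₂} <| by
    intro c hc hchain
    exact ⟨⋃₀ c, (Set.pairwise_sUnion hchain.directedOn).2 fun s hs => hc hs,
      fun s hs => Set.subset_sUnion_of_mem hs⟩
  refine ⟨K, hK.prop, fun x hx => ?_⟩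
  by_contra! hcon
  refine hx (hK.le_of_ge (y := insert x K) ?_ (Set.subset_insert x K) (Set.mem_insert x K))
  refine hK.prop.insert fun y hy _ => ?_
  exact ⟨wordDist_comm f w x y ▸ hcon y hy, hcon y hy⟩

/-- A maximal separated set provides a cover by strings. -/
theorem coverCard_univ_le_sepCard [CompactSpace X] (f : Y → X → X) (w : List Y) {ε : ℝ}
    (hε : 0 < ε) :
    coverCard f w ε Set.univ ≤ sepCard f w (ε / 4) Set.univ := by
  obtain ⟨K, hK, hmax⟩ := exists_maximal_wordDist_separated f w (ε / 4)
  have hKs : K.encard ≤ sepCard f w (ε / 4) Set.univ :=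
    le_iSup₂_of_le K (Set.subset_univ K) (le_iSup_of_le hK le_rfl)
  refine le_trans ?_ hKs
  rcases K.finite_or_infinite with hfin | hinf
  swap
  · simp [hinf.encard_eq]
  -- The radius must exceed ε/4, to catch points ε/4-close to `K`, while 2r < ε keeps the supremum
  -- of the diameters strictly below ε.
  let r : ℝ := 3 * ε / 8
  let 𝒰 : Set (Set X) := Set.range fun x => Metric.ball x r
  let U : X → Fin (w.length + 1) → Set X := fun x j =>
    Metric.ball (wordMap f (w.take j).reverse x) r
  have h𝒰 : 𝒰 ∈ openCovers X ε := by
    refine ⟨?_, ?_, ?_⟩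
    · rintro _ ⟨x, rfl⟩
      exact Metric.isOpen_ball
    · exact Set.eq_univ_of_forall fun x =>
        ⟨_, ⟨x, rfl⟩, Metric.mem_ball_self (by positivity)⟩
    · refine lt_of_le_of_lt (b := ENNReal.ofReal (2 * r)) ?_ ?_
      · refine iSup₂_le ?_
        rintro _ ⟨x, rfl⟩
        change Metric.ediam (Metric.ball x r) ≤ _
        rw [← Metric.eball_ofReal]
        refine Metric.ediam_eball_le.trans_eq ?_
        rw [ENNReal.ofReal_mul (by norm_num)]
        simp
      · exact (ENNReal.ofReal_lt_ofReal_iff hε).2 (by simp only [r]; linarith)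
  refine le_trans ?_ (Set.encard_image_le U K)
  refine iInf₂_le_of_le 𝒰 h𝒰 <| iInf₂_le_of_le (U '' K) (hfin.image U).countable <|
    iInf₂_le_of_le ?_ ?_ le_rfl
  · rintro _ ⟨x, _, rfl⟩ j
    exact ⟨_, rfl⟩
  · intro x _
    obtain ⟨y, hy, hyx⟩ : ∃ y ∈ K, wordDist f w y x ≤ ε / 4 := by
      by_cases hx : x ∈ K
      · exact ⟨x, hx, by rw [wordDist_self]; positivity⟩
      · exact hmax x hx
    refine Set.mem_biUnion (Set.mem_image_of_mem U hy) fun j => ?_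
    rw [Metric.mem_ball']
    have := dist_le_wordDist f w j y x
    simp only [r]
    linarith

end Counting

/-! ### Exponential growth rates and rescaling -/

section Growth

variable [MetricSpace X] [MeasurableSpace Y]

/-- Any admissible `lam` makes the weighted integral eventually less than 1, so the separated-set
integral is at most e^{lam(n+1)}; the extra 1 is lost in the limit. -/
theorem entropyAt_le_upperUmdimAt {f : Y → X → X} (hf : ∀ y, Continuous (f y)) {Z : Set X}
    (hZ : Dense Z) (ℙ : Measure (ℕ → Y)) (ε : ℝ) :
    entropyAt f ℙ ε ≤ upperUmdimAt f ℙ Z ε := by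
  refine le_sInf ?_
  rintro _ ⟨lam, hlam, rfl⟩
  have hlim : Tendsto (fun n : ℕ => ((lam * ((n + 1 : ℝ) / n) : ℝ) : EReal)) atTop
      (𝓝 (lam : EReal)) := by
    rw [EReal.tendsto_coe]
    have h1 : Tendsto (fun n : ℕ => lam * (1 + 1 / (n : ℝ))) atTop (𝓝 (lam * (1 + 0))) :=
      (tendsto_const_nhds.add tendsto_one_div_atTop_nhds_zero_nat).const_mul lam
    rw [add_zero, mul_one] at h1
    refine h1.congr' ?_
    filter_upwards [eventually_gt_atTop 0] with n hn
    have : (n : ℝ) ≠ 0 := by positivity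
    field_simp
  refine le_trans (limsup_le_limsup ?_) hlim.limsup_eq.le
  have hev : ∀ᶠ N : ℕ in atTop, coverSum f ℙ Z lam N ε < 1 :=
    eventually_lt_of_limsup_lt (by rw [hlam]; exact zero_lt_one)
  filter_upwards [hev, eventually_gt_atTop 0] with n hn hpos
  have hint : ENNReal.ofReal (Real.exp (-lam * (n + 1))) *
      ∫⁻ ω, (sepCard f (firstWord ω n) ε Set.univ : ENNReal) ∂ℙ ≤ 1 := by
    rw [← lintegral_const_mul' _ _ ENNReal.ofReal_ne_top]
    refine le_trans (lintegral_mono fun ω => ?_) hn.le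
    gcongr
    exact sepCard_univ_le_coverCard hf hZ _ _
  have hint' : ∫⁻ ω, (sepCard f (firstWord ω n) ε Set.univ : ENNReal) ∂ℙ ≤
      ENNReal.ofReal (Real.exp (lam * (n + 1))) := by
    have h0 : ENNReal.ofReal (Real.exp (-lam * (n + 1))) ≠ 0 := by
      simp [Real.exp_pos]
    rw [mul_comm, ← ENNReal.le_div_iff_mul_le (Or.inl h0) (Or.inl ENNReal.ofReal_ne_top),
      one_div, ← ENNReal.ofReal_inv_of_pos (Real.exp_pos _), ← Real.exp_neg] at hint
    simpa using hint
  have hn0 : (0 : EReal) < (n : EReal) := by exact_mod_cast hpos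
  rw [EReal.div_le_iff_le_mul hn0 (EReal.natCast_ne_top n)]
  refine (ENNReal.log_monotone hint').trans_eq ?_
  rw [ENNReal.log_ofReal_of_pos (Real.exp_pos _), Real.log_exp]
  have : (n : EReal) = ((n : ℝ) : EReal) := by simp
  rw [this, ← EReal.coe_mul]
  congr 1
  have : (n : ℝ) ≠ 0 := by positivity
  field_simp

theorem upperUmdimAt_univ_le_entropyAt [CompactSpace X] (f : Y → X → X) (ℙ : Measure (ℕ → Y))
    {ε : ℝ} (hε : 0 < ε) :
    upperUmdimAt f ℙ Set.univ ε ≤ entropyAt f ℙ (ε / 4) := by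
  refine EReal.le_of_forall_lt_iff_le.1 fun lam hlam => ?_
  -- The room between `mu` and `lam` gives the geometric decay e^{(mu-lam)n}.
  obtain ⟨mu, hmu, hmul⟩ := EReal.exists_between_coe_real hlam
  refine sInf_le ⟨lam, ?_, rfl⟩
  have hml : mu < lam := by exact_mod_cast hmul
  refine Tendsto.limsup_eq ?_
  have hlim : Tendsto (fun n : ℕ => ENNReal.ofReal (Real.exp (-lam) *
      Real.exp (mu - lam) ^ n)) atTop (𝓝 0) := by
    rw [← ENNReal.ofReal_zero]
    refine ENNReal.tendsto_ofReal ?_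
    have := (tendsto_pow_atTop_nhds_zero_of_lt_one (Real.exp_pos (mu - lam)).le
      (Real.exp_lt_one_iff.2 (by linarith))).const_mul (Real.exp (-lam))
    simpa using this
  refine tendsto_of_tendsto_of_tendsto_of_le_of_le' tendsto_const_nhds hlim
    (Eventually.of_forall fun _ => zero_le) ?_
  filter_upwards [eventually_lt_of_limsup_lt hmu, eventually_gt_atTop 0] with n hn hpos
  have hn0 : (0 : EReal) < (n : EReal) := by exact_mod_cast hpos
  have hlog := (EReal.div_le_iff_le_mul hn0 (EReal.natCast_ne_top n)).1 hn.le
  have hint : ∫⁻ ω, (sepCard f (firstWord ω n) (ε / 4) Set.univ : ENNReal) ∂ℙ ≤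
      ENNReal.ofReal (Real.exp (mu * n)) := by
    rw [← ENNReal.log_le_log_iff, ENNReal.log_ofReal_of_pos (Real.exp_pos _), Real.log_exp]
    refine hlog.trans_eq ?_
    simp [mul_comm]
  calc coverSum f ℙ Set.univ lam n ε
      ≤ ∫⁻ ω, ENNReal.ofReal (Real.exp (-lam * (n + 1))) *
          (sepCard f (firstWord ω n) (ε / 4) Set.univ : ENNReal) ∂ℙ := by
        refine lintegral_mono fun ω => ?_
        gcongr
        exact coverCard_univ_le_sepCard f _ hε
    _ ≤ ENNReal.ofReal (Real.exp (-lam * (n + 1))) * ENNReal.ofReal (Real.exp (mu * n)) := by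
        rw [lintegral_const_mul' _ _ ENNReal.ofReal_ne_top]
        gcongr
    _ = ENNReal.ofReal (Real.exp (-lam) * Real.exp (mu - lam) ^ n) := by
        rw [← ENNReal.ofReal_mul (Real.exp_pos _).le, ← Real.exp_add, ← Real.exp_nat_mul,
          ← Real.exp_add]
        congr 2
        ring

theorem upperUmdimAt_mono (f : Y → X → X) (ℙ : Measure (ℕ → Y)) (ε : ℝ) {Z Z' : Set X}
    (h : Z ⊆ Z') : upperUmdimAt f ℙ Z ε ≤ upperUmdimAt f ℙ Z' ε := by
  refine sInf_le_sInf (Set.image_mono fun lam hlam => ?_)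
  refine le_antisymm (le_trans (limsup_le_limsup (Eventually.of_forall fun N => ?_))
    (le_of_eq hlam)) zero_le
  refine lintegral_mono fun ω => ?_
  gcongr
  exact coverCard_mono f _ ε h

/-- Rescaling `ε` by a constant factor does not increase the growth rate against `log (1 / ε)`. -/
theorem limsup_div_log_rescale_le (h : ℝ → EReal) :
    limsup (fun ε : ℝ => h (ε / 4) / (Real.log (1 / ε) : EReal)) (𝓝[>] 0) ≤
      limsup (fun ε : ℝ => h ε / ((-Real.log ε : ℝ) : EReal)) (𝓝[>] 0) := by
  refine EReal.le_of_forall_lt_iff_le.1 fun c hc => ?_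
  have hscale : Tendsto (fun ε : ℝ => ε / 4) (𝓝[>] 0) (𝓝[>] 0) := by
    refine tendsto_nhdsWithin_iff.2 ⟨?_, ?_⟩
    · have : Tendsto (fun ε : ℝ => ε / 4) (𝓝 0) (𝓝 (0 / 4)) := tendsto_id.div_const 4
      rw [zero_div] at this
      exact this.mono_left nhdsWithin_le_nhds
    · filter_upwards [self_mem_nhdsWithin] with ε hε
      exact div_pos (Set.mem_Ioi.1 hε) (by norm_num)
  -- The correction factor is log(4/ε)/log(1/ε), which tends to 1.
  have hlim : Tendsto (fun ε : ℝ => ((c * (1 + Real.log 4 / (-Real.log ε)) : ℝ) : EReal))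
      (𝓝[>] 0) (𝓝 (c : EReal)) := by
    rw [EReal.tendsto_coe]
    have h1 : Tendsto (fun ε : ℝ => -Real.log ε) (𝓝[>] 0) atTop :=
      tendsto_neg_atBot_atTop.comp Real.tendsto_log_nhdsGT_zero
    have h2 := ((h1.const_div_atTop (Real.log 4)).const_add 1).const_mul c
    simpa using h2
  refine le_trans (limsup_le_limsup ?_) hlim.limsup_eq.le
  filter_upwards [hscale.eventually (eventually_lt_of_limsup_lt hc),
    Ioo_mem_nhdsGT (show (0 : ℝ) < 1 by norm_num)] with ε hε h01
  have hlog : 0 < -Real.log ε := neg_pos.2 (Real.log_neg h01.1 h01.2)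
  have hlog4 : -Real.log (ε / 4) = -Real.log ε + Real.log 4 := by
    rw [Real.log_div h01.1.ne' (by norm_num)]
    ring
  have hpos4 : 0 < -Real.log ε + Real.log 4 := by
    have := Real.log_pos (show (1 : ℝ) < 4 by norm_num)
    linarith
  rw [hlog4] at hε
  have hle := (EReal.div_le_iff_le_mul (by exact_mod_cast hpos4) (EReal.coe_ne_top _)).1 hε.le
  rw [one_div, Real.log_inv,
    EReal.div_le_iff_le_mul (by exact_mod_cast hlog) (EReal.coe_ne_top _)]
  refine hle.trans_eq ?_
  rw [← EReal.coe_mul, ← EReal.coe_mul]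
  congr 1
  rw [mul_left_comm, mul_add, mul_one, mul_div_cancel₀ _ hlog.ne', mul_comm]

/-- The upper metric mean dimension is computed by any dense subset. -/
theorem upperUmdim_eq_of_dense [CompactSpace X] {f : Y → X → X} (hf : ∀ y, Continuous (f y))
    {Z : Set X} (hZ : Dense Z) (ℙ : Measure (ℕ → Y)) :
    upperUmdim f ℙ Z = upperMdimM f ℙ := by
  have hpos : ∀ᶠ ε : ℝ in 𝓝[>] 0, 0 < ε ∧ 0 ≤ Real.log (1 / ε) := by
    filter_upwards [Ioo_mem_nhdsGT (show (0 : ℝ) < 1 by norm_num)] with ε h01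
    refine ⟨h01.1, ?_⟩
    rw [one_div, Real.log_inv]
    exact (neg_pos.2 (Real.log_neg h01.1 h01.2)).le
  refine le_antisymm (le_trans (limsup_le_limsup ?_) (limsup_div_log_rescale_le (entropyAt f ℙ)))
    (limsup_le_limsup ?_)
  · filter_upwards [hpos] with ε ⟨h0, hl⟩
    exact EReal.div_le_div_right_of_nonneg (by exact_mod_cast hl)
      ((upperUmdimAt_mono f ℙ ε (Set.subset_univ Z)).trans (upperUmdimAt_univ_le_entropyAt f ℙ h0))
  · filter_upwards [hpos] with ε ⟨h0, hl⟩
    have he : -Real.log ε = Real.log (1 / ε) := by rw [one_div, Real.log_inv]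
    rw [he]
    exact EReal.div_le_div_right_of_nonneg (by exact_mod_cast hl)
      (entropyAt_le_upperUmdimAt hf hZ ℙ ε)

end Growth

/-! ### Gluing infinitely many segments -/

section Gluing

theorem glueWord_congr (w : ℕ → List Y) {v v' : ℕ → List Y} {j : ℕ} (h : ∀ i < j, v i = v' i) :
    glueWord w v j = glueWord w v' j := by
  induction j with
  | zero => rfl
  | succ j ih =>
    simp only [glueWord]
    rw [h j j.lt_succ_self, ih fun i hi => h i (hi.trans j.lt_succ_self)]

/-- Gluing of infinitely many orbit segments, with the gaps filled by a constant letter. -/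
theorem GluingOrbitProperty.exists_infinite [MetricSpace X] [CompactSpace X] {f : Y → X → X}
    (hglue : GluingOrbitProperty f) (hf : ∀ y, Continuous (f y)) {ε : ℝ} (hε : 0 < ε) :
    ∃ P : ℕ, ∀ (y : Y) (x : ℕ → X) (w : ℕ → List Y), (∀ j, 0 < (w j).length) →
      ∃ (p : ℕ → ℕ) (z : X), (∀ j, p j ≤ P) ∧ ∀ j i,
        dist (wordMap f ((w j).take i).reverse (x j)) (wordMap f ((w j).take i).reverse
          (wordMap f (glueWord w (fun l => List.replicate (p l) y) j) z)) ≤ ε := by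
  obtain ⟨P, -, hP⟩ := hglue ε hε
  refine ⟨P, fun y x w hw => ?_⟩
  -- The gluing property asks for at least two segments, hence `k + 2`.
  choose q hq hv using fun k : ℕ => hP (k + 2) (by omega) x w (fun j _ => hw j)
  choose z hz using fun k => hv k (fun l => List.replicate (q k l) y) (by simp)
  -- A nonprincipal ultrafilter replaces diagonal extraction: each gap length takes finitely many
  -- values, so it is constant along `F`, and the gluing points converge along `F` by compactness.
  let F : Ultrafilter ℕ := hyperfilter ℕ
  have hF : (F : Filter ℕ) ≤ atTop := Nat.hyperfilter_le_atTop
  have hp : ∀ j, ∃ p ≤ P, ∀ᶠ k in F, q k j = p := by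
    intro j
    have hmem : Set.Iic P ∈ F.map fun k => q k j := by
      have : ∀ᶠ k in F, q k j ≤ P := by
        filter_upwards [hF (eventually_ge_atTop j)] with k hk
        have hk : j ≤ k := hk
        exact hq k j (by omega)
      exact this
    obtain ⟨p, hp, hpure⟩ := Ultrafilter.eq_pure_of_finite_mem (Set.finite_Iic P) hmem
    refine ⟨p, hp, ?_⟩
    have : {p} ∈ F.map fun k => q k j := by rw [hpure]; exact rfl
    exact this
  choose p hpP hpF using hp
  obtain ⟨z', -, hz'⟩ := isCompact_univ.ultrafilter_le_nhds (F.map z) (by simp)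
  have hlim : Tendsto z F (𝓝 z') := hz'
  refine ⟨p, z', hpP, fun j i => ?_⟩
  have hcont : Continuous fun t => dist (wordMap f ((w j).take i).reverse (x j))
      (wordMap f ((w j).take i).reverse
        (wordMap f (glueWord w (fun l => List.replicate (p l) y) j) t)) :=
    continuous_const.dist ((continuous_wordMap hf _).comp (continuous_wordMap hf _))
  refine le_of_tendsto ((hcont.tendsto z').comp hlim) ?_
  have hev : ∀ᶠ k in F, ∀ l ∈ Set.Iio j, q k l = p l :=
    (eventually_all_finite (Set.finite_Iio j)).2 fun l _ => hpF l
  filter_upwards [hev, hF (eventually_ge_atTop j)] with k hk hjk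
  have hjk : j ≤ k := hjk
  have hball : wordMap f (glueWord w (fun l => List.replicate (p l) y) j) (z k) ∈
      bowenBall f (w j) (x j) ε := by
    rw [← glueWord_congr w (v := fun l => List.replicate (q k l) y)
      (fun l hl => by rw [hk l hl])]
    rcases Nat.eq_zero_or_pos j with rfl | hj
    · exact (hz k).1
    · exact Set.mem_iInter₂.1 (hz k).2 j (Finset.mem_Ico.2 ⟨hj, by omega⟩)
  exact (dist_le_wordDist f (w j) i _ _).trans (le_of_lt hball)

end Gluing

/-! ### Averages and oscillation -/

section Averages

variable {E : Type*} [NormedAddCommGroup E] [NormedSpace ℝ E]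

/-- A short initial piece of bounded terms has little effect on an average. -/
theorem dist_average_le {u u' : ℕ → E} {C η : ℝ} {M n : ℕ} (hn : 0 < n)
    (hu : ∀ i, ‖u i‖ ≤ C) (hu' : ∀ i, ‖u' i‖ ≤ C) (h : ∀ i < n, dist (u (M + i)) (u' i) ≤ η) :
    dist ((1 / ((M + n : ℕ) : ℝ)) • ∑ i ∈ Finset.range (M + n), u i)
      ((1 / (n : ℝ)) • ∑ i ∈ Finset.range n, u' i) ≤ η + 2 * C * (M / n) := by
  have hn' : (0 : ℝ) < n := by exact_mod_cast hn
  have hT : (0 : ℝ) < M + n := by positivity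
  have hC : 0 ≤ C := (norm_nonneg _).trans (hu 0)
  have hη : 0 ≤ η := dist_nonneg.trans (h 0 hn)
  have hsplit : (1 / ((M + n : ℕ) : ℝ)) • ∑ i ∈ Finset.range (M + n), u i -
      (1 / (n : ℝ)) • ∑ i ∈ Finset.range n, u' i =
      (1 / ((M : ℝ) + n)) • (∑ i ∈ Finset.range M, u i +
        ∑ i ∈ Finset.range n, (u (M + i) - u' i) -
        ((M : ℝ) / n) • ∑ i ∈ Finset.range n, u' i) := by
    rw [Finset.sum_range_add, Finset.sum_sub_distrib]
    push_cast
    match_scalars <;> field_simp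
    ring
  have h₁ : ‖∑ i ∈ Finset.range M, u i‖ ≤ M * C := by
    simpa using norm_sum_le_of_le (Finset.range M) fun i _ => hu i
  have h₂ : ‖∑ i ∈ Finset.range n, (u (M + i) - u' i)‖ ≤ n * η := by
    refine (norm_sum_le_of_le (Finset.range n) fun i hi => ?_).trans_eq (b := ∑ _ ∈ _, η) (by simp)
    rw [← dist_eq_norm]
    exact h i (Finset.mem_range.1 hi)
  have h₃ : ‖((M : ℝ) / n) • ∑ i ∈ Finset.range n, u' i‖ ≤ M * C := by
    have h₄ : ‖∑ i ∈ Finset.range n, u' i‖ ≤ n * C := by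
      simpa using norm_sum_le_of_le (Finset.range n) fun i _ => hu' i
    rw [norm_smul, Real.norm_of_nonneg (by positivity)]
    calc (M : ℝ) / n * _ ≤ (M : ℝ) / n * (n * C) := by gcongr
      _ = M * C := by field_simp
  rw [dist_eq_norm, hsplit, norm_smul, Real.norm_of_nonneg (by positivity), one_div,
    inv_mul_le_iff₀ hT]
  calc _ ≤ M * C + n * η + M * C :=
        (norm_sub_le _ _).trans (add_le_add ((norm_add_le _ _).trans (add_le_add h₁ h₂)) h₃)
    _ ≤ M * C + n * η + M * C + (M * η + 2 * C * (M / n) * M) := by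
        have : 0 ≤ M * η + 2 * C * (M / n) * M := by positivity
        linarith
    _ = (M + n) * (η + 2 * C * (M / n)) := by
        field_simp
        ring

/-- Two far-apart late terms cannot both be near `c`. Since `c` is arbitrary, each new time can be
chosen against the average at the previous one. -/
theorem exists_dist_ge_of_not_cauchySeq {α : Type*} [PseudoMetricSpace α] {a : ℕ → α}
    (ha : ¬ CauchySeq a) : ∃ δ > 0, ∀ (N : ℕ) (c : α), ∃ n ≥ N, δ ≤ dist (a n) c := by
  rw [Metric.cauchySeq_iff] at ha
  push Not at ha
  obtain ⟨δ, hδ, h⟩ := ha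
  refine ⟨δ / 2, by positivity, fun N c => ?_⟩
  obtain ⟨m, hm, n, hn, hmn⟩ := h N
  by_contra! hcon
  have h1 := hcon m hm
  have h2 := hcon n hn
  have := dist_triangle_right (a m) (a n) c
  linarith

/-- Rapidly growing times along which a non-Cauchy sequence keeps oscillating; `B j` bounds the
time spent before the `j`-th time, gaps of length at most `P` included. -/
theorem exists_oscillating_times {α : Type*} [PseudoMetricSpace α] {a : ℕ → α} {δ : ℝ}
    (ha : ∀ (N : ℕ) (c : α), ∃ n ≥ N, δ ≤ dist (a n) c) (P : ℕ) :
    ∃ n B : ℕ → ℕ, B 0 = 0 ∧ (∀ j, B (j + 1) = B j + n j + P) ∧ (∀ j, 0 < n j) ∧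
      (∀ j, j * B j ≤ n j) ∧ ∀ j, δ ≤ dist (a (n (j + 1))) (a (n j)) := by
  choose g hg hd using ha
  -- The state is `(n j, B j)`; the threshold (j+1)·B(j+1)+1 yields both rapid growth and
  -- positivity.
  let s : ℕ → ℕ × ℕ := fun j => Nat.rec (1, 0) (fun j t =>
    (g ((j + 1) * (t.2 + t.1 + P) + 1) (a t.1), t.2 + t.1 + P)) j
  refine ⟨fun j => (s j).1, fun j => (s j).2, rfl, fun j => rfl, ?_, ?_, fun j => hd _ _⟩
  · rintro (_ | j)
    · exact Nat.one_pos
    · exact (Nat.succ_pos _).trans_le (hg _ _)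
  · rintro (_ | j)
    · simp
    · exact (Nat.le_succ _).trans (hg _ _)

end Averages

/-! ### Density of the irregular set -/

/-- Under the gluing orbit property, a nonempty irregular set is dense. -/
theorem dense_irregularSet [MetricSpace X] [CompactSpace X] {E : Type*} [NormedAddCommGroup E]
    [NormedSpace ℝ E] [CompleteSpace E] {f : Y → X → X} (hf : ∀ y, Continuous (f y))
    (hglue : GluingOrbitProperty f) {φ : X → E} (hφ : Continuous φ)
    (hne : (irregularSet f φ).Nonempty) : Dense (irregularSet f φ) := by
  obtain ⟨x₀, ω₀, hω₀⟩ := hne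
  have : Nonempty Y := ⟨ω₀ 0⟩
  obtain ⟨C, hC⟩ := isCompact_univ.exists_bound_of_continuousOn hφ.continuousOn
  replace hC : ∀ x, ‖φ x‖ ≤ C := fun x => hC x trivial
  obtain ⟨δ, hδ, hosc⟩ := exists_dist_ge_of_not_cauchySeq
    fun h => hω₀ (cauchySeq_tendsto_of_complete h)
  obtain ⟨ρ, hρ, hφρ⟩ := Metric.uniformContinuous_iff.1
    (CompactSpace.uniformContinuous_of_continuous hφ) (δ / 8) (by positivity)
  refine Metric.dense_iff.2 fun t r hr => ?_
  obtain ⟨ε, hε, hεr⟩ := exists_between (lt_min hr hρ)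
  obtain ⟨P, hP⟩ := hglue.exists_infinite hf hε
  obtain ⟨n, B, hB0, hB, hn, hBn, hdist⟩ := exists_oscillating_times hosc P
  let w : ℕ → List Y := fun j => firstWord ω₀ (n j)
  -- Segment 0 shadows `t` and places `z` near it; all later ones shadow `x₀`.
  obtain ⟨p, z, hp, hz⟩ := hP (ω₀ 0) (fun j => if j = 0 then t else x₀) w
    (fun j => by simpa [w] using hn j)
  let v : ℕ → List Y := fun l => List.replicate (p l) (ω₀ 0)
  -- `W j` is the word read before segment `j`; these nested prefixes define `ω`.
  let W : ℕ → List Y := fun j => (glueWord w v j).reverse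
  have hWsucc : ∀ j, W (j + 1) = W j ++ (w j ++ v j) := fun j => by simp [W, glueWord]
  have hWlen : ∀ j, j ≤ (W j).length ∧ (W j).length ≤ B j := by
    intro j
    induction j with
    | zero => simp [W, glueWord]
    | succ j ih =>
      have h1 := hn j
      have h2 := hp j
      rw [hWsucc, hB]
      simp only [List.length_append, w, v, length_firstWord, List.length_replicate]
      omega
  obtain ⟨ω, hω⟩ := exists_firstWord_eq W (fun j => ⟨_, (hWsucc j).symm⟩) fun j => (hWlen j).1
  have hωW : ∀ j, ∀ i < n j, firstWord ω ((W j).length + i) = W j ++ firstWord ω₀ i := by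
    intro j i hi
    have hle : (W j).length + i ≤ (W (j + 1)).length := by
      rw [hWsucc]
      simp [w]
      omega
    rw [← take_firstWord ω hle, hω, hWsucc, List.take_length_add_append,
      List.take_append_of_le_length (by simpa [w] using hi.le), take_firstWord ω₀ hi.le]
  refine ⟨z, ?_, ω, ?_⟩
  · have h0 := hz 0 0
    simp only [List.take_zero, List.reverse_nil, wordMap, glueWord, if_true, id] at h0
    rw [Metric.mem_ball']
    exact h0.trans_lt (hεr.trans_le (min_le_left _ _))
  rintro ⟨l, hl⟩
  have hclose : ∀ j, 0 < j → dist
      ((1 / (((W j).length + n j : ℕ) : ℝ)) • ∑ i ∈ Finset.range ((W j).length + n j),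
        φ (wordMap f (firstWord ω i).reverse z))
      ((1 / (n j : ℝ)) • ∑ i ∈ Finset.range (n j), φ (wordMap f (firstWord ω₀ i).reverse x₀)) ≤
      δ / 8 + 2 * C * (1 / j) := by
    intro j hj
    have hC0 : 0 ≤ C := (norm_nonneg _).trans (hC t)
    refine (dist_average_le (hn j) (fun i => hC _) (fun i => hC _) fun i hi => ?_).trans
      (b := δ / 8 + 2 * C * ((W j).length / n j)) ?_
    · rw [hωW j i hi, List.reverse_append, wordMap_append]
      refine (hφρ ?_).le
      have h := hz j i
      rw [if_neg hj.ne', take_firstWord ω₀ hi.le, dist_comm] at h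
      simp only [W, List.reverse_reverse]
      exact h.trans_lt (hεr.trans_le (min_le_right _ _))
    · gcongr δ / 8 + 2 * C * ?_
      rw [div_le_div_iff₀ (by exact_mod_cast hn j) (by exact_mod_cast hj)]
      have h1 : (W j).length * j ≤ 1 * n j := by
        rw [one_mul, mul_comm]
        exact (Nat.mul_le_mul_left j (hWlen j).2).trans (hBn j)
      exact_mod_cast h1
  have hT : Tendsto (fun j => (W j).length + n j) atTop atTop :=
    tendsto_atTop_mono (fun j => (hWlen j).1.trans (Nat.le_add_right _ _)) tendsto_id
  -- Three errors of δ/8: shadowing, the initial piece, and the assumed convergence. Two consecutive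
  -- averages of `x₀` would then differ by less than 6δ/8 < δ.
  have hev : ∀ᶠ j in atTop, dist ((1 / (n j : ℝ)) • ∑ i ∈ Finset.range (n j),
      φ (wordMap f (firstWord ω₀ i).reverse x₀)) l < 3 * δ / 8 := by
    have hsmall : Tendsto (fun j : ℕ => 2 * C * (1 / (j : ℝ))) atTop (𝓝 0) := by
      simpa using tendsto_one_div_atTop_nhds_zero_nat.const_mul (2 * C)
    filter_upwards [hsmall.eventually (gt_mem_nhds (show 0 < δ / 8 by positivity)),
      (hl.comp hT).eventually (Metric.ball_mem_nhds l (show 0 < δ / 8 by positivity)),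
      eventually_gt_atTop 0] with j h1 h2 h3
    have h4 := hclose j h3
    rw [dist_comm] at h4
    have h5 := (dist_triangle _ _ l).trans_lt (add_lt_add_of_le_of_lt h4 h2)
    linarith
  obtain ⟨j, hj, hj'⟩ := (hev.and ((tendsto_add_atTop_nat 1).eventually hev)).exists
  have h1 := hdist j
  have h2 := dist_triangle_right ((1 / (n (j + 1) : ℝ)) • ∑ i ∈ Finset.range (n (j + 1)),
      φ (wordMap f (firstWord ω₀ i).reverse x₀)) ((1 / (n j : ℝ)) • ∑ i ∈ Finset.range (n j),
      φ (wordMap f (firstWord ω₀ i).reverse x₀)) l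
  linarith

end FreeSemigroup

theorem theorem3 {X Y : Type*} [MetricSpace X] [CompactSpace X] [MetricSpace Y] [CompactSpace Y]
    [MeasurableSpace Y] [BorelSpace Y] (f : Y → X → X) (hf : ∀ y, Continuous (f y))
    (hglue : FreeSemigroup.GluingOrbitProperty f)
    (hbox : FreeSemigroup.upperBoxDim Y < ⊤)
    (ν : Measure Y) [IsProbabilityMeasure ν]
    (hν : FreeSemigroup.IsHomogeneous ν) (hsupp : ν.support = Set.univ)
    (m : ℕ) (φ : X → EuclideanSpace ℝ (Fin m)) (hφ : Continuous φ)
    (hne : (FreeSemigroup.irregularSet f φ).Nonempty) :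
    FreeSemigroup.upperUmdim f (FreeSemigroup.randomWalk ν) (FreeSemigroup.irregularSet f φ) =
        FreeSemigroup.upperMdimM f (FreeSemigroup.randomWalk ν) ∧
      FreeSemigroup.upperMdimM f (FreeSemigroup.randomWalk ν) =
        FreeSemigroup.upperUmdim f (FreeSemigroup.randomWalk ν) Set.univ := by
  have hdense := FreeSemigroup.dense_irregularSet hf hglue hφ hne
  have hI := FreeSemigroup.upperUmdim_eq_of_dense hf hdense (FreeSemigroup.randomWalk ν)
  exact ⟨hI, (FreeSemigroup.upperUmdim_eq_of_dense hf dense_univ _).symm⟩
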